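/- For integers $n\ge 3$ and $1\le k\le n-1$, the generalized Petersen graph $\mathrm{GP}(n,k)$ is the simple graph with vertices $u_i, v_i$ $(i\in\mathbb{Z}_n)$ and edges $u_iu_{i+1}$, $v_iv_{i+k}$, $u_iv_i$ $(i\in\mathbb{Z}_n)$. (The case $k=n/2$, in which the edges $v_iv_{i+k}$ form a perfect matching on the $v_i$, is allowed here; it occurs below only for $\mathrm{GP}(6,3)$.) A finite graph $X$ with distance function $d$ is *strongly distance-balanced* if for every edge $uv$ of $X$ and every integer $i\ge 0$, $$|\{x : d(x,u)=i+1,\ d(x,v)=i\}| = |\{x : d(x,u)=i,\ d(x,v)=i+1\}|.$$ **Theorem.** Let $k$ be a positive integer. Then the following hold. (i) If $k\equiv 0 \pmod 3$, then $\mathrm{GP}(3k+3,k)$ is not strongly distance-balanced. (ii) If $k\not\equiv 0 \pmod 3$, then $\mathrm{GP}(3k+3,k)$ is strongly distance-balanced, or it is isomorphic to $\mathrm{GP}(9,2)$. (iii) If $k\ge 2$ and $k\equiv 0 \pmod 3$, then $\mathrm{GP}(3k-3,k)$ is not strongly distance-balanced. (iv) If $k\ge 2$ and $k\not\equiv 0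 \pmod 3$, then $\mathrm{GP}(3k-3,k)$ is strongly distance-balanced, or it is isomorphic to $\mathrm{GP}(9,4)$. Moreover $\mathrm{GP}(9,4)\cong\mathrm{GP}(9,2)$, and $\mathrm{GP}(9,2)$ is not strongly distance-balanced. -/

import Mathlib

/-- The set `D^i_j(u,v)` of all vertices `x` at distance `i` from `u` and at distance `j`
from `v` in the graph `X`. -/
def distCell {V : Type*} (X : SimpleGraph V) (i j : ℕ) (u v : V) : Set V :=
  {x | X.dist u x = i ∧ X.dist v x = j}

/-- A graph is strongly distance-balanced if for every edge `uv` and every `i` the number of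
vertices at distance `i + 1` from `u` and `i` from `v` equals the number of vertices at
distance `i` from `u` and `i + 1` from `v`. -/
def IsStronglyDistanceBalanced {V : Type*} (X : SimpleGraph V) : Prop :=
  ∀ u v : V, X.Adj u v → ∀ i : ℕ,
    (distCell X (i + 1) i u v).encard = (distCell X i (i + 1) u v).encard

/-- The oriented edges `u_i → u_{i+1}`, `v_i → v_{i+k}`, `u_i → v_i`, where
`Sum.inl i` stands for `u_i` and `Sum.inr i` for `v_i`. -/
def petersenRel (n k : ℕ) : ZMod n ⊕ ZMod n → ZMod n ⊕ ZMod n → Prop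
  | Sum.inl i, Sum.inl j => j = i + 1
  | Sum.inr i, Sum.inr j => j = i + (k : ZMod n)
  | Sum.inl i, Sum.inr j => j = i
  | Sum.inr _, Sum.inl _ => False

/-- The generalized Petersen graph `GP(n,k)`, of interest for `n ≥ 3` and `1 ≤ k ≤ n - 1`:
vertices `u_i`, `v_i` for `i` in `ZMod n`, and edges `u_i u_{i+1}`, `v_i v_{i+k}`, `u_i v_i`. -/
def GP (n k : ℕ) : SimpleGraph (ZMod n ⊕ ZMod n) :=
  SimpleGraph.fromRel (petersenRel n k)

/-!
Across an edge `uv` distances differ by at most one, so the two cells compared in the definition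
of strong distance-balancedness are the two differences of the balls of radius `i` around `u`
and `v`. Hence a connected finite graph is strongly distance-balanced iff adjacent vertices have
balls of equal size at every radius.

In `GP n k` a walk with `a` outer and `b` inner steps (with signs) moves the index by `a + k * b`,
and all outer and all inner steps can be grouped together. So its distances are explicit:
two spokes are needed to join vertices of the same rim with mixed steps, one spoke to join
vertices of different rims, none to stay on one rim (`WithinDist`, `GP_dist_le_iff`). The part of
a ball on the opposite rim has the same size for `u_i` and `v_i`. What remains
(`isStronglyDistanceBalanced_GP_iff`) is to compare, for each `m`, the integers `|c| ≤ m` whose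
class `c` is not of the form `a + k * b` with `|a| + |b| ≤ m - 2`, with those for which `k * c` is
not of this form, both counted modulo `n` through the classes `c` and `k * c`.

* If `k ^ 2 = 1` modulo `n`, multiplication by `k` exchanges the roles of `a` and `b`. This is the
  case `k ≡ 1` of `n = 3k + 3` and the case `k ≡ 2` of `n = 3k - 3`.
* If `n = 3k + 3`, `k ≡ 2` modulo `3` and `k ≥ 5`, then `k` is still a unit, and `c` and `k * c`
  are of the form above for the same `c`: reduction modulo `k + 1`, where `k = -1`, gives the lower
  bound on `|a| + |b|`, and the relations `c = (c - k) + k` and `k * c = 2 + k * (c - k + 1)` attain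
  it. For `n = 3k - 3`, `k ≡ 1`, one has `k * (k - 2) = -1`, so multiplication by `k - 2` is an
  isomorphism onto the previous graph for `k - 2`. The same map gives `GP 9 4 ≃g GP 9 2`.
* If `3` divides `k` and `n = 3M` with `M = k ± 1`, then `k * M = 0`, so multiplication by `k`
  identifies `⌈M / 2⌉` and `⌈M / 2⌉ - M`, and the second count is smaller than the first for
  `m = ⌈M / 2⌉`.
-/

/-! ### Balls in a connected graph -/

section Balls

variable {V W : Type*}

/-- The closed ball of radius `m` around `u` in the graph distance of `X`. -/
def distBall (X : SimpleGraph V) (m : ℕ) (u : V) : Set V :=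
  {x | X.dist u x ≤ m}

theorem distBall_sdiff_distBall {X : SimpleGraph V} (hX : X.Connected) {u v : V}
    (huv : X.Adj u v) (m : ℕ) :
    distBall X m u \ distBall X m v = distCell X m (m + 1) u v := by
  ext x
  have h1 : X.dist v x ≤ X.dist v u + X.dist u x := hX.dist_triangle
  have h2 : X.dist v u = 1 := SimpleGraph.dist_eq_one_iff_adj.2 huv.symm
  simp only [distBall, distCell, Set.mem_sdiff, Set.mem_ofPred_eq]
  omega

/-- Across an edge distances differ by at most one, so the two cells of a level are the two
differences of balls of the same radius. -/
theorem isStronglyDistanceBalanced_iff_ncard_distBall [Finite V] {X : SimpleGraph V}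
    (hX : X.Connected) :
    IsStronglyDistanceBalanced X ↔
      ∀ u v, X.Adj u v → ∀ m, (distBall X m u).ncard = (distBall X m v).ncard := by
  refine forall₂_congr fun u v => forall_congr' fun huv => forall_congr' fun m => ?_
  have hc : distCell X (m + 1) m u v = distCell X m (m + 1) v u := by
    ext x; exact and_comm
  rw [hc, ← distBall_sdiff_distBall hX huv, ← distBall_sdiff_distBall hX huv.symm,
    ← Set.encard_eq_encard_iff_encard_sdiff_eq_encard_sdiff (Set.toFinite _),
    ← (Set.toFinite (distBall X m v)).cast_ncard_eq,
    ← (Set.toFinite (distBall X m u)).cast_ncard_eq, Nat.cast_inj, eq_comm]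

theorem SimpleGraph.Iso.dist_apply {X : SimpleGraph V} {Y : SimpleGraph W} (f : X ≃g Y)
    (hX : X.Connected) (u v : V) : Y.dist (f u) (f v) = X.dist u v := by
  have hY : Y.Connected := f.connected_iff.1 hX
  apply le_antisymm
  · obtain ⟨p, hp⟩ := hX.exists_walk_length_eq_dist u v
    rw [← hp, ← SimpleGraph.Walk.length_map f.toHom p]
    exact SimpleGraph.dist_le _
  · obtain ⟨p, hp⟩ := hY.exists_walk_length_eq_dist (f u) (f v)
    rw [← hp, ← SimpleGraph.Walk.length_map f.symm.toHom p]
    have := SimpleGraph.dist_le (p.map f.symm.toHom)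
    simpa using this

theorem IsStronglyDistanceBalanced.of_iso {X : SimpleGraph V} {Y : SimpleGraph W} (f : X ≃g Y)
    (hX : X.Connected) (hY : IsStronglyDistanceBalanced Y) : IsStronglyDistanceBalanced X := by
  have key (i j : ℕ) (u v : V) :
      (distCell X i j u v).encard = (distCell Y i j (f u) (f v)).encard := by
    rw [← f.injective.encard_image]
    congr 1
    ext y
    obtain ⟨x, rfl⟩ := f.surjective y
    rw [f.injective.mem_set_image]
    simp [distCell, f.dist_apply hX]
  intro u v huv i
  rw [key, key]
  exact hY _ _ (f.map_adj_iff.2 huv) i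

end Balls

/-! ### Distances in generalized Petersen graphs -/

section GPDist

variable {n k : ℕ}

@[simp] theorem GP_adj_inl_inr {i j : ZMod n} : (GP n k).Adj (.inl i) (.inr j) ↔ j = i := by
  simp [GP, petersenRel]

@[simp] theorem GP_adj_inr_inl {i j : ZMod n} : (GP n k).Adj (.inr i) (.inl j) ↔ i = j := by
  simp [GP, petersenRel]

@[simp] theorem GP_adj_inl_inl {i j : ZMod n} :
    (GP n k).Adj (.inl i) (.inl j) ↔ i ≠ j ∧ (j = i + 1 ∨ i = j + 1) := by
  simp [GP, petersenRel]

@[simp] theorem GP_adj_inr_inr {i j : ZMod n} :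
    (GP n k).Adj (.inr i) (.inr j) ↔ i ≠ j ∧ (j = i + k ∨ i = j + k) := by
  simp [GP, petersenRel]

/-- Displacements of the walks that take `a` outer and `b` inner steps and two spokes, of total
length at most `m`. -/
def mixedSet (n k m : ℕ) : Set (ZMod n) :=
  {x | ∃ a b : ℤ, (a + k * b : ZMod n) = x ∧ a.natAbs + b.natAbs + 2 ≤ m}

/-- Displacements of the walks of length at most `m` along the outer rim. -/
def outerSet (n m : ℕ) : Set (ZMod n) :=
  {x | ∃ a : ℤ, (a : ZMod n) = x ∧ a.natAbs ≤ m}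

/-- Displacements of the walks of length at most `m` along the inner edges. -/
def innerSet (n k m : ℕ) : Set (ZMod n) :=
  {x | ∃ b : ℤ, (k * b : ZMod n) = x ∧ b.natAbs ≤ m}

/-- The explicit description of "at distance at most `m`" in `GP n k`: between rims of different
kind one spoke is enough, and `mixedSet n k (m + 1)` then accounts for a budget of `m`. -/
def WithinDist (n k m : ℕ) : ZMod n ⊕ ZMod n → ZMod n ⊕ ZMod n → Prop
  | .inl i, .inl j => j - i ∈ mixedSet n k m ∪ outerSet n m
  | .inl i, .inr j => j - i ∈ mixedSet n k (m + 1)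
  | .inr i, .inl j => j - i ∈ mixedSet n k (m + 1)
  | .inr i, .inr j => j - i ∈ mixedSet n k m ∪ innerSet n k m

theorem WithinDist.refl (x : ZMod n ⊕ ZMod n) : WithinDist n k 0 x x := by
  rcases x with i | i
  · exact .inr ⟨0, by simp, by simp⟩
  · exact .inr ⟨0, by simp, by simp⟩

theorem WithinDist.mono {m m' : ℕ} (h : m ≤ m') {x y : ZMod n ⊕ ZMod n}
    (hxy : WithinDist n k m x y) : WithinDist n k m' x y := by
  rcases x with i | i <;> rcases y with j | j
  · rcases hxy with ⟨a, b, e, h'⟩ | ⟨a, e, h'⟩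
    · exact .inl ⟨a, b, e, by omega⟩
    · exact .inr ⟨a, e, by omega⟩
  · obtain ⟨a, b, e, h'⟩ := hxy
    exact ⟨a, b, e, by omega⟩
  · obtain ⟨a, b, e, h'⟩ := hxy
    exact ⟨a, b, e, by omega⟩
  · rcases hxy with ⟨a, b, e, h'⟩ | ⟨a, e, h'⟩
    · exact .inl ⟨a, b, e, by omega⟩
    · exact .inr ⟨a, e, by omega⟩

theorem WithinDist.outer_step {m : ℕ} {i j : ZMod n} {s : ℤ} (hs : s.natAbs ≤ 1)
    (hij : j = i + s) {z : ZMod n ⊕ ZMod n} (h : WithinDist n k m (.inl j) z) :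
    WithinDist n k (m + 1) (.inl i) z := by
  subst hij
  rcases z with l | l
  · rcases h with ⟨a, b, e, h'⟩ | ⟨a, e, h'⟩
    · exact .inl ⟨a + s, b, by push_cast; linear_combination e, by omega⟩
    · exact .inr ⟨a + s, by push_cast; linear_combination e, by omega⟩
  · obtain ⟨a, b, e, h'⟩ := h
    exact ⟨a + s, b, by push_cast; linear_combination e, by omega⟩

theorem WithinDist.inner_step {m : ℕ} {i j : ZMod n} {s : ℤ} (hs : s.natAbs ≤ 1)
    (hij : j = i + k * s) {z : ZMod n ⊕ ZMod n} (h : WithinDist n k m (.inr j) z) :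
    WithinDist n k (m + 1) (.inr i) z := by
  subst hij
  rcases z with l | l
  · obtain ⟨a, b, e, h'⟩ := h
    exact ⟨a, b + s, by push_cast; linear_combination e, by omega⟩
  · rcases h with ⟨a, b, e, h'⟩ | ⟨a, e, h'⟩
    · exact .inl ⟨a, b + s, by push_cast; linear_combination e, by omega⟩
    · exact .inr ⟨a + s, by push_cast; linear_combination e, by omega⟩

theorem WithinDist.spoke_in {m : ℕ} {i : ZMod n} {z : ZMod n ⊕ ZMod n}
    (h : WithinDist n k m (.inr i) z) : WithinDist n k (m + 1) (.inl i) z := by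
  rcases z with l | l
  · exact .inl h
  · rcases h with ⟨a, b, e, h'⟩ | ⟨b, e, h'⟩
    · exact ⟨a, b, e, by omega⟩
    · exact ⟨0, b, by push_cast; linear_combination e, by omega⟩

theorem WithinDist.spoke_out {m : ℕ} {i : ZMod n} {z : ZMod n ⊕ ZMod n}
    (h : WithinDist n k m (.inl i) z) : WithinDist n k (m + 1) (.inr i) z := by
  rcases z with l | l
  · rcases h with ⟨a, b, e, h'⟩ | ⟨a, e, h'⟩
    · exact ⟨a, b, e, by omega⟩
    · exact ⟨a, 0, by push_cast; linear_combination e, by omega⟩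
  · exact .inl h

theorem WithinDist.of_adj {m : ℕ} {x y z : ZMod n ⊕ ZMod n} (hxy : (GP n k).Adj x y)
    (h : WithinDist n k m y z) : WithinDist n k (m + 1) x z := by
  rcases x with i | i <;> rcases y with j | j
  · rcases (GP_adj_inl_inl.1 hxy).2 with e | e
    · exact h.outer_step (s := 1) (by simp) (by push_cast; linear_combination e)
    · exact h.outer_step (s := -1) (by simp) (by push_cast; linear_combination -e)
  · rw [GP_adj_inl_inr.1 hxy] at h
    exact h.spoke_in
  · rw [← GP_adj_inr_inl.1 hxy] at h
    exact h.spoke_out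
  · rcases (GP_adj_inr_inr.1 hxy).2 with e | e
    · exact h.inner_step (s := 1) (by simp) (by push_cast; linear_combination e)
    · exact h.inner_step (s := -1) (by simp) (by push_cast; linear_combination -e)

theorem WithinDist.of_walk {x y : ZMod n ⊕ ZMod n} (p : (GP n k).Walk x y) :
    WithinDist n k p.length x y := by
  induction p with
  | nil => exact .refl _
  | cons h _ ih => exact .of_adj h ih

/-- Steps along the outer rim form a walk, except that the successive vertices coincide when
`n = 1`; hence the bound on the length rather than its value. -/
theorem exists_walk_outer_nat (i : ZMod n) (a : ℕ) :
    ∃ p : (GP n k).Walk (.inl i) (.inl (i + a)), p.length ≤ a := by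
  induction a with
  | zero => exact ⟨SimpleGraph.Walk.nil.copy rfl (by simp), by simp⟩
  | succ a ih =>
    obtain ⟨p, hp⟩ := ih
    have e : i + ((a + 1 : ℕ) : ZMod n) = i + a + 1 := by push_cast; ring
    rw [e]
    by_cases h : i + (a : ZMod n) = i + a + 1
    · rw [← h]
      exact ⟨p, by omega⟩
    · exact ⟨p.concat (GP_adj_inl_inl.2 ⟨h, .inl rfl⟩), by simpa using hp⟩

theorem exists_walk_inner_nat (i : ZMod n) (b : ℕ) :
    ∃ p : (GP n k).Walk (.inr i) (.inr (i + k * b)), p.length ≤ b := by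
  induction b with
  | zero => exact ⟨SimpleGraph.Walk.nil.copy rfl (by simp), by simp⟩
  | succ b ih =>
    obtain ⟨p, hp⟩ := ih
    have e : i + k * ((b + 1 : ℕ) : ZMod n) = i + k * b + k := by push_cast; ring
    rw [e]
    by_cases h : i + (k * b : ZMod n) = i + k * b + k
    · rw [← h]
      exact ⟨p, by omega⟩
    · exact ⟨p.concat (GP_adj_inr_inr.2 ⟨h, .inl rfl⟩), by simpa using hp⟩

theorem exists_walk_outer {i j : ZMod n} (a : ℤ) (h : (a : ZMod n) = j - i) :
    ∃ p : (GP n k).Walk (.inl i) (.inl j), p.length ≤ a.natAbs := by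
  obtain ⟨c, rfl | rfl⟩ := a.eq_nat_or_neg
  · obtain rfl : j = i + c := by push_cast at h; linear_combination -h
    simpa using exists_walk_outer_nat i c
  · obtain rfl : i = j + c := by push_cast at h; linear_combination h
    obtain ⟨p, hp⟩ := exists_walk_outer_nat (k := k) j c
    exact ⟨p.reverse, by simpa using hp⟩

theorem exists_walk_inner {i j : ZMod n} (b : ℤ) (h : (k * b : ZMod n) = j - i) :
    ∃ p : (GP n k).Walk (.inr i) (.inr j), p.length ≤ b.natAbs := by
  obtain ⟨c, rfl | rfl⟩ := b.eq_nat_or_neg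
  · obtain rfl : j = i + k * c := by push_cast at h; linear_combination -h
    simpa using exists_walk_inner_nat i c
  · obtain rfl : i = j + k * c := by push_cast at h; linear_combination h
    obtain ⟨p, hp⟩ := exists_walk_inner_nat (k := k) j c
    exact ⟨p.reverse, by simpa using hp⟩

theorem exists_walk_outer_inner {i j : ZMod n} (a b : ℤ) (h : (a + k * b : ZMod n) = j - i) :
    ∃ p : (GP n k).Walk (.inl i) (.inr j), p.length ≤ a.natAbs + b.natAbs + 1 := by
  obtain ⟨p, hp⟩ := exists_walk_outer (k := k) (i := i) (j := i + (a : ZMod n)) a (by ring)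
  obtain ⟨q, hq⟩ := exists_walk_inner (i := i + (a : ZMod n)) (j := j) b (by linear_combination h)
  refine ⟨(p.concat (GP_adj_inl_inr.2 rfl)).append q, ?_⟩
  simp only [SimpleGraph.Walk.length_append, SimpleGraph.Walk.length_concat]
  omega

theorem WithinDist.exists_walk {m : ℕ} {x y : ZMod n ⊕ ZMod n} (h : WithinDist n k m x y) :
    ∃ p : (GP n k).Walk x y, p.length ≤ m := by
  rcases x with i | i <;> rcases y with j | j
  · rcases h with ⟨a, b, e, h'⟩ | ⟨a, e, h'⟩
    · obtain ⟨p, hp⟩ := exists_walk_outer_inner a b e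
      refine ⟨p.concat (GP_adj_inr_inl.2 rfl), ?_⟩
      rw [SimpleGraph.Walk.length_concat]
      omega
    · obtain ⟨p, hp⟩ := exists_walk_outer (k := k) a e
      exact ⟨p, by omega⟩
  · obtain ⟨a, b, e, h'⟩ := h
    obtain ⟨p, hp⟩ := exists_walk_outer_inner a b e
    exact ⟨p, by omega⟩
  · obtain ⟨a, b, e, h'⟩ := h
    obtain ⟨p, hp⟩ := exists_walk_outer_inner (k := k) (i := j) (j := i) (-a) (-b)
      (by push_cast; linear_combination -e)
    refine ⟨p.reverse, ?_⟩
    rw [SimpleGraph.Walk.length_reverse]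
    omega
  · rcases h with ⟨a, b, e, h'⟩ | ⟨b, e, h'⟩
    · obtain ⟨p, hp⟩ := exists_walk_outer_inner a b e
      refine ⟨.cons (GP_adj_inr_inl.2 rfl) p, ?_⟩
      rw [SimpleGraph.Walk.length_cons]
      omega
    · obtain ⟨p, hp⟩ := exists_walk_inner b e
      exact ⟨p, by omega⟩

theorem GP_connected : (GP n k).Connected := by
  have h0 (x : ZMod n ⊕ ZMod n) : (GP n k).Reachable (.inl 0) x := by
    rcases x with i | i
    · obtain ⟨p, -⟩ := exists_walk_outer (n := n) (k := k) (i := 0) (j := i) i.cast (by simp)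
      exact p.reachable
    · obtain ⟨p, -⟩ := exists_walk_outer_inner (n := n) (k := k) (i := 0) (j := i) i.cast 0
        (by simp)
      exact p.reachable
  exact ⟨fun x y => (h0 x).symm.trans (h0 y)⟩

theorem GP_dist_le_iff {m : ℕ} {x y : ZMod n ⊕ ZMod n} :
    (GP n k).dist x y ≤ m ↔ WithinDist n k m x y := by
  constructor
  · intro h
    obtain ⟨p, hp⟩ := GP_connected.exists_walk_length_eq_dist x y
    exact (WithinDist.of_walk p).mono (hp.trans_le h)
  · intro h
    obtain ⟨p, hp⟩ := h.exists_walk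
    exact (SimpleGraph.dist_le p).trans hp

/-! ### Reduction to counting displacements -/

theorem ncard_set_sum {α β : Type*} [Finite α] [Finite β] (S : Set (α ⊕ β)) :
    S.ncard = (Sum.inl ⁻¹' S).ncard + (Sum.inr ⁻¹' S).ncard := by
  conv_lhs => rw [← Set.image_preimage_inl_union_image_preimage_inr S]
  rw [Set.ncard_union_eq Set.disjoint_image_inl_image_inr,
    Set.ncard_image_of_injective _ Sum.inl_injective,
    Set.ncard_image_of_injective _ Sum.inr_injective]

theorem ncard_preimage_sub_right {G : Type*} [AddGroup G] (i : G) (S : Set G) :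
    ((fun j => j - i) ⁻¹' S).ncard = S.ncard :=
  Set.ncard_preimage_of_injective_subset_range sub_left_injective
    fun x _ => ⟨x + i, add_sub_cancel_right x i⟩

theorem ncard_distBall_inl [NeZero n] (m : ℕ) (i : ZMod n) :
    (distBall (GP n k) m (.inl i)).ncard =
      (mixedSet n k m ∪ outerSet n m).ncard + (mixedSet n k (m + 1)).ncard := by
  rw [ncard_set_sum, ← ncard_preimage_sub_right i (_ ∪ _),
    ← ncard_preimage_sub_right i (mixedSet n k (m + 1))]
  congr 2 <;> ext j <;> exact GP_dist_le_iff

theorem ncard_distBall_inr [NeZero n] (m : ℕ) (i : ZMod n) :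
    (distBall (GP n k) m (.inr i)).ncard =
      (mixedSet n k m ∪ innerSet n k m).ncard + (mixedSet n k (m + 1)).ncard := by
  rw [ncard_set_sum, add_comm, ← ncard_preimage_sub_right i (_ ∪ _),
    ← ncard_preimage_sub_right i (mixedSet n k (m + 1))]
  congr 2 <;> ext j <;> exact GP_dist_le_iff

/-- Strong distance-balancedness of `GP n k` only concerns the spokes, and there only the
vertices on the same rim as the centre of the ball. -/
theorem isStronglyDistanceBalanced_GP_iff [NeZero n] :
    IsStronglyDistanceBalanced (GP n k) ↔ ∀ m,
      (mixedSet n k m ∪ outerSet n m).ncard = (mixedSet n k m ∪ innerSet n k m).ncard := by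
  rw [isStronglyDistanceBalanced_iff_ncard_distBall GP_connected]
  constructor
  · intro h m
    have := h (.inl 0) (.inr 0) (GP_adj_inl_inr.2 rfl) m
    rw [ncard_distBall_inl, ncard_distBall_inr] at this
    omega
  · rintro h (i | i) (j | j) - m <;>
      simp only [ncard_distBall_inl, ncard_distBall_inr, h m]

end GPDist

/-! ### Families that are strongly distance-balanced -/

section Balanced

variable {n k : ℕ}

theorem isStronglyDistanceBalanced_GP_of_mul_self [NeZero n] (h : (k * k : ZMod n) = 1) :
    IsStronglyDistanceBalanced (GP n k) := by
  rw [isStronglyDistanceBalanced_GP_iff]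
  intro m
  have hinj : Function.Injective fun x : ZMod n => (k : ZMod n) * x :=
    Function.LeftInverse.injective (g := fun x => (k : ZMod n) * x) fun x => by
      linear_combination x * h
  rw [← Set.ncard_image_of_injective _ hinj, Set.image_union]
  -- Multiplication by `k` turns `a + k * b` into `b + k * a`.
  congr 2
  · ext x
    constructor
    · rintro ⟨-, ⟨a, b, rfl, hab⟩, rfl⟩
      exact ⟨b, a, by linear_combination -b * h, by omega⟩
    · rintro ⟨a, b, rfl, hab⟩
      exact ⟨b + k * a, ⟨b, a, rfl, by omega⟩, by linear_combination a * h⟩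
  · ext x
    constructor
    · rintro ⟨-, ⟨a, rfl, ha⟩, rfl⟩
      exact ⟨a, rfl, ha⟩
    · rintro ⟨a, rfl, ha⟩
      exact ⟨a, ⟨a, rfl, ha⟩, rfl⟩

/-- If `k * l = -1` in `ZMod n`, then multiplication by `l` followed by exchanging the rims is an
isomorphism from `GP n k` to `GP n l`. -/
theorem nonempty_GP_iso_of_mul_eq_neg_one {l : ℕ} (h : (k * l : ZMod n) = -1) :
    Nonempty (GP n k ≃g GP n l) := by
  have hinj : Function.Injective fun x : ZMod n => (l : ZMod n) * x :=
    Function.LeftInverse.injective (g := fun x => -(k : ZMod n) * x) fun x => by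
      linear_combination -x * h
  let e : ZMod n ⊕ ZMod n ≃ ZMod n ⊕ ZMod n :=
    { toFun := Sum.elim (fun j => .inr (l * j)) fun j => .inl (l * j)
      invFun := Sum.elim (fun j => .inr (-k * j)) fun j => .inl (-k * j)
      left_inv := by
        rintro (j | j) <;> simp only [Sum.elim_inl, Sum.elim_inr] <;> congr 1 <;>
          linear_combination -j * h
      right_inv := by
        rintro (j | j) <;> simp only [Sum.elim_inl, Sum.elim_inr] <;> congr 1 <;>
          linear_combination -j * h }
  refine ⟨⟨e, ?_⟩⟩
  rintro (i | i) (j | j)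
  · have h1 (i j : ZMod n) : l * j = l * i + l ↔ j = i + 1 := by
      rw [← hinj.eq_iff (a := j)]
      simp only [mul_add, mul_one]
    simp [e, h1, hinj.eq_iff.not]
  · simp [e, hinj.eq_iff, eq_comm]
  · simp [e, hinj.eq_iff, eq_comm]
  · have h1 (i j : ZMod n) : l * i = l * j + 1 ↔ j = i + k := by
      rw [← hinj.eq_iff (a := j)]
      constructor <;> intro h' <;> linear_combination -h' - h
    simp [e, h1, hinj.eq_iff.not, or_comm]

/-- If membership in `mixedSet` of a displacement along the outer rim is preserved by
multiplication by the unit `k`, then this multiplication matches the displacements reached only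
along the outer rim with those reached only along inner edges. -/
theorem isStronglyDistanceBalanced_GP_of_mem_mixedSet_iff [NeZero n] (hk : IsUnit (k : ZMod n))
    (h : ∀ (m : ℕ) (c : ℤ), c.natAbs ≤ m →
      ((c : ZMod n) ∈ mixedSet n k m ↔ (k * c : ZMod n) ∈ mixedSet n k m)) :
    IsStronglyDistanceBalanced (GP n k) := by
  rw [isStronglyDistanceBalanced_GP_iff]
  intro m
  have himage : (fun x : ZMod n => (k : ZMod n) * x) '' (outerSet n m \ mixedSet n k m) =
      innerSet n k m \ mixedSet n k m := by
    ext x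
    constructor
    · rintro ⟨-, ⟨⟨c, rfl, hc⟩, hcm⟩, rfl⟩
      exact ⟨⟨c, rfl, hc⟩, fun hx => hcm ((h m c hc).2 hx)⟩
    · rintro ⟨⟨c, rfl, hc⟩, hcm⟩
      exact ⟨c, ⟨⟨c, rfl, hc⟩, fun hx => hcm ((h m c hc).1 hx)⟩, rfl⟩
  rw [← Set.union_sdiff_self, ← Set.union_sdiff_self (t := innerSet n k m),
    Set.ncard_union_eq Set.disjoint_sdiff_right, Set.ncard_union_eq Set.disjoint_sdiff_right,
    ← himage, Set.ncard_image_of_injective _ hk.mul_right_injective]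

theorem mixedSet_neg_mem {m : ℕ} {x : ZMod n} (h : x ∈ mixedSet n k m) :
    -x ∈ mixedSet n k m := by
  obtain ⟨a, b, rfl, hab⟩ := h
  exact ⟨-a, -b, by push_cast; ring, by omega⟩

/-- Modulo a divisor `M` of `n` with `k ≡ s` modulo `M` and `s = ± 1`, an element of `mixedSet`
is congruent to an integer of absolute value at most `m - 2`. -/
theorem exists_dvd_sub_of_mem_mixedSet {m : ℕ} {M s c : ℤ} (hMn : M ∣ n) (hs : M ∣ k - s)
    (hs1 : s = 1 ∨ s = -1) (h : (c : ZMod n) ∈ mixedSet n k m) :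
    ∃ d : ℤ, M ∣ c - d ∧ d.natAbs + 2 ≤ m := by
  obtain ⟨a, b, e, hab⟩ := h
  refine ⟨a + s * b, ?_, by rcases hs1 with rfl | rfl <;> omega⟩
  have e' : ((a + k * b : ℤ) : ZMod n) = (c : ℤ) := by push_cast; exact e
  rw [ZMod.intCast_eq_intCast_iff_dvd_sub] at e'
  have h1 := dvd_add (hMn.trans e') (hs.mul_right b)
  rwa [show c - (a + k * b) + (k - s) * b = c - (a + s * b) by ring] at h1

/-- A congruence modulo `M` between integers in `[-m, m]` and `[-(m - 2), m - 2]` is an equality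
unless `M` is at most the sum of their absolute values. -/
theorem natAbs_add_two_le_or_of_dvd_sub {m M : ℕ} {c d : ℤ} (hd : d.natAbs + 2 ≤ m)
    (h : (M : ℤ) ∣ c - d) : c.natAbs + 2 ≤ m ∨ M + 2 ≤ c.natAbs + m := by
  by_cases hcd : c = d
  · exact .inl (hcd ▸ hd)
  · have := Int.natAbs_le_of_dvd_ne_zero h (by omega)
    omega

/-- Both the displacement `c` along the outer rim and `k * c` along inner edges have a shortcut
with two spokes exactly when `k + 3 ≤ |c| + m`, unless they are themselves at most `m - 2`. -/
theorem isStronglyDistanceBalanced_GP_three_mul_add_three (hk : k % 3 = 2) (hk5 : 5 ≤ k) :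
    IsStronglyDistanceBalanced (GP (3 * k + 3) k) := by
  have : NeZero (3 * k + 3) := ⟨by omega⟩
  have hn : (3 * k + 3 : ZMod (3 * k + 3)) = 0 := by
    have := ZMod.natCast_self (3 * k + 3)
    push_cast at this
    exact this
  obtain ⟨t, hkt⟩ : ∃ t, k = 3 * t + 2 := ⟨k / 3, by omega⟩
  set n := 3 * k + 3 with hnk
  have ht : (k : ZMod n) = 3 * t + 2 := by exact_mod_cast congrArg (Nat.cast (R := ZMod n)) hkt
  -- The relation `(k - 2) * (k + 1) = 0` in `ZMod n`.
  have hrel : ((k : ZMod n) - 2) * (k + 1) = 0 := by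
    linear_combination (k + 1 : ZMod n) * ht + (t : ZMod n) * hn
  have hunit : IsUnit (k : ZMod n) :=
    IsUnit.of_mul_eq_one (-(k + 2) : ZMod n) (by linear_combination -hrel - hn)
  refine isStronglyDistanceBalanced_GP_of_mem_mixedSet_iff hunit fun m c hc => ?_
  have hMn : ((k + 1 : ℕ) : ℤ) ∣ (n : ℤ) := ⟨3, by rw [hnk]; push_cast; ring⟩
  have hs : ((k + 1 : ℕ) : ℤ) ∣ k - (-1) := ⟨1, by push_cast; ring⟩
  have key1 : (c : ZMod n) ∈ mixedSet n k m ↔ c.natAbs + 2 ≤ m ∨ k + 3 ≤ c.natAbs + m := by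
    constructor
    · intro h
      obtain ⟨d, hd, hdm⟩ := exists_dvd_sub_of_mem_mixedSet hMn hs (.inr rfl) h
      exact natAbs_add_two_le_or_of_dvd_sub hdm hd
    · rintro (h | h)
      · exact ⟨c, 0, by simp, by simpa using h⟩
      · have hpos (c : ℕ) (hc : c ≤ m) (h : k + 3 ≤ c + m) : (c : ZMod n) ∈ mixedSet n k m :=
          ⟨c - k, 1, by push_cast; ring, by omega⟩
        obtain ⟨c, rfl | rfl⟩ := c.eq_nat_or_neg
        · exact_mod_cast hpos c (by omega) (by omega)
        · have := mixedSet_neg_mem (hpos c (by omega) (by omega))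
          push_cast
          exact this
  have key2 : (k * c : ZMod n) ∈ mixedSet n k m ↔
      c.natAbs + 2 ≤ m ∨ k + 3 ≤ c.natAbs + m := by
    constructor
    · intro h
      have h' : ((k * c : ℤ) : ZMod n) ∈ mixedSet n k m := by push_cast; exact h
      obtain ⟨d, hd, hdm⟩ := exists_dvd_sub_of_mem_mixedSet hMn hs (.inr rfl) h'
      rw [← Int.natAbs_neg d] at hdm
      refine natAbs_add_two_le_or_of_dvd_sub hdm (d := -d) ?_
      -- `k * c` is congruent to `-c` modulo `k + 1`.
      have h1 := dvd_sub (hs.mul_right c) hd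
      rwa [show (k - -1 : ℤ) * c - (k * c - d) = c - -d by ring] at h1
    · rintro (h | h)
      · exact ⟨0, c, by simp, by simpa using h⟩
      · have hpos (c : ℕ) (hc : c ≤ m) (h : k + 3 ≤ c + m) :
            (k * c : ZMod n) ∈ mixedSet n k m :=
          ⟨2, c - k + 1, by push_cast; linear_combination -hrel, by omega⟩
        obtain ⟨c, rfl | rfl⟩ := c.eq_nat_or_neg
        · exact_mod_cast hpos c (by omega) (by omega)
        · have := mixedSet_neg_mem (hpos c (by omega) (by omega))
          push_cast
          rwa [mul_neg]
  rw [key1, key2]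

end Balanced

/-! ### Families that are not strongly distance-balanced -/

section NotBalanced

variable {n k : ℕ}

/-- Here `k` is not a unit: it is killed by `M`. For `m = ⌈M / 2⌉` the displacements `m` and
`m - M` are both reached only along the outer rim, but multiplication by `k` identifies them, so
fewer displacements are reached only along inner edges. -/
theorem not_isStronglyDistanceBalanced_GP {M : ℕ} {s : ℤ} (hM : 2 ≤ M) (hn : n = 3 * M)
    (hs : (M : ℤ) ∣ k - s) (hs1 : s = 1 ∨ s = -1) (hkM : (k * M : ZMod n) = 0) :
    ¬ IsStronglyDistanceBalanced (GP n k) := by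
  have : NeZero n := ⟨by omega⟩
  rw [isStronglyDistanceBalanced_GP_iff]
  intro h
  obtain ⟨m, hm⟩ : ∃ m, m = (M + 1) / 2 := ⟨_, rfl⟩
  have hmem (c : ℤ) (hc : (c : ZMod n) ∈ mixedSet n k m) :
      c.natAbs + 2 ≤ m ∨ M + 2 ≤ c.natAbs + m := by
    obtain ⟨d, hd, hdm⟩ := exists_dvd_sub_of_mem_mixedSet ⟨3, by rw [hn]; push_cast; ring⟩
      hs hs1 hc
    exact natAbs_add_two_le_or_of_dvd_sub hdm hd
  set S := outerSet n m \ mixedSet n k m with hS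
  have hmS : (m : ZMod n) ∈ S := by
    refine ⟨⟨m, by simp, by simp⟩, fun hx => ?_⟩
    have := hmem m (by exact_mod_cast hx)
    omega
  have hmS' : (m - M : ZMod n) ∈ S := by
    refine ⟨⟨m - M, by simp, by omega⟩, fun hx => ?_⟩
    have := hmem (m - M) (by push_cast; exact hx)
    omega
  have hne : (m - M : ZMod n) ≠ m := by
    intro h0
    have h1 : (M : ZMod n) = 0 := by linear_combination -h0
    rw [ZMod.natCast_eq_zero_iff, hn] at h1
    have := Nat.le_of_dvd (by omega) h1
    omega
  have hsub : mixedSet n k m ∪ innerSet n k m ⊆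
      mixedSet n k m ∪ (fun x : ZMod n => (k : ZMod n) * x) '' (S \ {(m : ZMod n)}) := by
    rintro x (hx | ⟨c, rfl, hc⟩)
    · exact .inl hx
    by_cases hcm : (c : ZMod n) ∈ mixedSet n k m
    · rcases hmem c hcm with h1 | h1
      · exact .inl ⟨0, c, by simp, by simpa using h1⟩
      · omega
    right
    by_cases hcm' : (c : ZMod n) = m
    · exact ⟨m - M, ⟨hmS', hne⟩, by rw [hcm']; linear_combination -hkM⟩
    · exact ⟨c, ⟨⟨⟨c, rfl, hc⟩, hcm⟩, hcm'⟩, rfl⟩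
  have hle := (Set.ncard_le_ncard hsub).trans ((Set.ncard_union_le _ _).trans
    (Nat.add_le_add_left (Set.ncard_image_le (Set.toFinite _)) _))
  have hlt : (S \ {(m : ZMod n)}).ncard < S.ncard := Set.ncard_sdiff_singleton_lt_of_mem hmS
  have hU := h m
  rw [← Set.union_sdiff_self, Set.ncard_union_eq Set.disjoint_sdiff_right, ← hS] at hU
  omega

/-- In `GP 9 2` the ball of radius `3` around an inner vertex contains the whole inner rim,
whereas the ball of radius `3` around an outer vertex misses a vertex of the outer rim. -/
theorem not_isStronglyDistanceBalanced_GP_nine_two :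
    ¬ IsStronglyDistanceBalanced (GP 9 2) := by
  rw [isStronglyDistanceBalanced_GP_iff]
  intro h
  have huniv : mixedSet 9 2 3 ∪ innerSet 9 2 3 = Set.univ := by
    have hmix (a b : ℤ) (hab : a.natAbs + b.natAbs + 2 ≤ 3) :
        (a + (2 : ℕ) * b : ZMod 9) ∈ mixedSet 9 2 3 ∪ innerSet 9 2 3 := .inl ⟨a, b, rfl, hab⟩
    have hinn (b : ℤ) (hb : b.natAbs ≤ 3) :
        ((2 : ℕ) * b : ZMod 9) ∈ mixedSet 9 2 3 ∪ innerSet 9 2 3 := .inr ⟨b, rfl, hb⟩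
    rw [Set.eq_univ_iff_forall]
    intro x
    fin_cases x
    exacts [hinn 0 (by decide), hmix 1 0 (by decide), hinn 1 (by decide), hinn (-3) (by decide),
      hinn 2 (by decide), hinn (-2) (by decide), hinn 3 (by decide), hinn (-1) (by decide),
      hmix (-1) 0 (by decide)]
  have h4 : (4 : ZMod 9) ∉ mixedSet 9 2 3 ∪ outerSet 9 3 := by
    rintro (⟨a, b, e, hab⟩ | ⟨a, e, ha⟩)
    · have e' : ((a + 2 * b : ℤ) : ZMod 9) = (4 : ℤ) := by push_cast at e ⊢; exact e
      rw [ZMod.intCast_eq_intCast_iff_dvd_sub] at e'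
      omega
    · have e' : (a : ZMod 9) = (4 : ℤ) := by exact_mod_cast e
      rw [ZMod.intCast_eq_intCast_iff_dvd_sub] at e'
      omega
  have h3 := h 3
  rw [huniv] at h3
  exact h4 (Set.eq_univ_iff_ncard _ |>.2 (h3.trans (Set.ncard_univ _)) ▸ Set.mem_univ _)

end NotBalanced

theorem theorem4p5 (k : ℕ) (hk : 1 ≤ k) :
    (k ≡ 0 [MOD 3] → ¬ IsStronglyDistanceBalanced (GP (3 * k + 3) k)) ∧
    (¬ k ≡ 0 [MOD 3] →
      IsStronglyDistanceBalanced (GP (3 * k + 3) k) ∨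
        Nonempty (GP (3 * k + 3) k ≃g GP 9 2)) ∧
    (2 ≤ k → k ≡ 0 [MOD 3] → ¬ IsStronglyDistanceBalanced (GP (3 * k - 3) k)) ∧
    (2 ≤ k → ¬ k ≡ 0 [MOD 3] →
      IsStronglyDistanceBalanced (GP (3 * k - 3) k) ∨
        Nonempty (GP (3 * k - 3) k ≃g GP 9 4)) ∧
    Nonempty (GP 9 4 ≃g GP 9 2) ∧
    ¬ IsStronglyDistanceBalanced (GP 9 2) := by
  unfold Nat.ModEq
  refine ⟨fun h0 => ?_, fun h0 => ?_, fun h2 h0 => ?_, fun h2 h0 => ?_,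
    nonempty_GP_iso_of_mul_eq_neg_one (by decide), not_isStronglyDistanceBalanced_GP_nine_two⟩
  · refine not_isStronglyDistanceBalanced_GP (M := k + 1) (s := -1) (by omega) (by omega)
      ⟨1, by push_cast; ring⟩ (.inr rfl) ?_
    obtain ⟨t, ht⟩ : ∃ t, k = 3 * t := ⟨k / 3, by omega⟩
    rw [← Nat.cast_mul, ZMod.natCast_eq_zero_iff]
    exact ⟨t, by nth_rw 1 [ht]; ring⟩
  · by_cases h1 : k % 3 = 1
    · left
      have : NeZero (3 * k + 3) := ⟨by omega⟩
      apply isStronglyDistanceBalanced_GP_of_mul_self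
      obtain ⟨t, ht⟩ : ∃ t, k = 3 * t + 1 := ⟨k / 3, by omega⟩
      rw [← Nat.cast_mul, ← sub_eq_zero, ← Nat.cast_one, ← Nat.cast_sub (by nlinarith),
        ZMod.natCast_eq_zero_iff]
      refine ⟨t, Nat.sub_eq_of_eq_add ?_⟩
      rw [ht]; ring
    · by_cases h5 : 5 ≤ k
      · exact .inl (isStronglyDistanceBalanced_GP_three_mul_add_three (by omega) h5)
      · obtain rfl : k = 2 := by omega
        exact .inr ⟨SimpleGraph.Iso.refl⟩
  · obtain ⟨t, ht⟩ : ∃ t, k = 3 * t + 3 := ⟨k / 3 - 1, by omega⟩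
    refine not_isStronglyDistanceBalanced_GP (M := k - 1) (s := 1) (by omega) (by omega)
      ⟨1, by push_cast [hk]; ring⟩ (.inl rfl) ?_
    rw [← Nat.cast_mul, ZMod.natCast_eq_zero_iff]
    subst ht
    exact ⟨t + 1, by
      rw [show 3 * t + 3 - 1 = 3 * t + 2 by omega,
        show 3 * (3 * t + 3) - 3 = 3 * (3 * t + 2) by omega]
      ring⟩
  · by_cases h1 : k % 3 = 2
    · left
      obtain ⟨t, rfl⟩ : ∃ t, k = 3 * t + 2 := ⟨k / 3, by omega⟩
      rw [show 3 * (3 * t + 2) - 3 = 9 * t + 3 by omega]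
      apply isStronglyDistanceBalanced_GP_of_mul_self
      have hn := ZMod.natCast_self (9 * t + 3)
      push_cast at hn ⊢
      linear_combination (t + 1 : ZMod (9 * t + 3)) * hn
    · by_cases h7 : 7 ≤ k
      · left
        -- `k * (k - 2) = (k - 1) ^ 2 - 1`, and `3 * (k - 1)` divides `(k - 1) ^ 2`.
        obtain ⟨t, rfl⟩ : ∃ t, k = 3 * t + 2 + 2 := ⟨k / 3 - 1, by omega⟩
        have e : 3 * (3 * t + 2 + 2) - 3 = 3 * (3 * t + 2) + 3 := by omega
        rw [e]
        have hn := ZMod.natCast_self (3 * (3 * t + 2) + 3)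
        obtain ⟨f⟩ := nonempty_GP_iso_of_mul_eq_neg_one (n := 3 * (3 * t + 2) + 3)
          (k := 3 * t + 2 + 2) (l := 3 * t + 2) (by
            push_cast at hn ⊢
            linear_combination (t + 1 : ZMod (3 * (3 * t + 2) + 3)) * hn)
        exact .of_iso f GP_connected
          (isStronglyDistanceBalanced_GP_three_mul_add_three (by omega) (by omega))
      · obtain rfl : k = 4 := by omega
        exact .inr ⟨SimpleGraph.Iso.refl⟩
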